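/- A local ring is assumed to be Noetherian. A filtration $\mathcal I=\{I_n\}_{n\in\mathbb N}$ on a local ring $R$ with maximal ideal $m_R$ is a descending chain of ideals $R=I_0\supset I_1\supset I_2\supset\cdots$ such that $I_iI_j\subset I_{i+j}$ for all $i,j$; its Rees algebra is $R[\mathcal I]=\sum_{n\ge 0}I_nt^n\subset R[t]$ and its analytic spread is the Krull dimension $\ell(\mathcal I)=\dim R[\mathcal I]/m_RR[\mathcal I]$. Let $R$ be a local domain with quotient field $K$. A divisorial valuation of $R$ is a valuation $\nu$ of $K$ whose valuation ring $\mathcal O_\nu$, with maximal ideal $m_\nu$, contains $R$ and such that, with $\mathfrak p=m_\nu\cap R$ the center of $\nu$ on $R$, the transcendence degree of the residue field of $\mathcal O_\nu$ over the residue field of $R_{\mathfrak p}$ is $\operatorname{ht}(\mathfrak p)-1$. For $n\in\mathbb N$ put $I(\nu)_n=m_\nu^n\cap R$ (which is $\{f\in R\mid \nu(f)\ge n\}$, such a $\nu$ being a discrete valuation). Theorem. Let $R$ be a local domain, let $r\ge 1$, let $\nu_1,\ldots,\nu_r$ be divisorial valuations of $R$, let $a_1,\ldots,a_r$ be positive integers,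 and let $\mathcal I=\{I_n\}$ be the filtration on $R$ with $$I_n=I(\nu_1)_{a_1n}\cap\cdots\cap I(\nu_r)_{a_rn}\qquad\text{for all } n\ge 1.$$ Suppose that $\ell(\mathcal I)=\dim R$. Then for some $i$ the center $m_{\nu_i}\cap R$ of $\nu_i$ on $R$ is $m_R$. Moreover, each $I_n$ with $n\ge 1$ is integrally closed, $I_n=\overline{I_n}$, and there exists a positive integer $n_0$ such that $m_R$ is an associated prime of $I_n$ (that is, of the $R$-module $R/I_n$) for all $n\ge n_0$. -/

import Mathlib

/-- A filtration of ideals on a commutative ring `R`: a descending chain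
`R = I₀ ⊇ I₁ ⊇ I₂ ⊇ ⋯` of ideals with `Iᵢ Iⱼ ⊆ Iᵢ₊ⱼ`. -/
structure IdealFiltration (R : Type*) [CommRing R] where
  ideal : ℕ → Ideal R
  ideal_zero : ideal 0 = ⊤
  antitone : Antitone ideal
  mul_le : ∀ i j, ideal i * ideal j ≤ ideal (i + j)

namespace IdealFiltration

variable {R : Type*} [CommRing R]

/-- The Rees algebra `R[I] = ∑ Iₙ tⁿ ⊆ R[t]` of a filtration. -/
def rees (I : IdealFiltration R) : Subalgebra R (Polynomial R) where
  carrier := {f | ∀ n, f.coeff n ∈ I.ideal n}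
  mul_mem' := by
    intro f g hf hg n
    rw [Polynomial.coeff_mul]
    refine Ideal.sum_mem _ fun p hp => ?_
    rw [← Finset.HasAntidiagonal.mem_antidiagonal.mp hp]
    exact I.mul_le _ _ (Ideal.mul_mem_mul (hf _) (hg _))
  add_mem' := by
    intro f g hf hg n
    rw [Polynomial.coeff_add]
    exact Ideal.add_mem _ (hf n) (hg n)
  algebraMap_mem' := by
    intro x n
    rw [Polynomial.algebraMap_eq, Polynomial.coeff_C]
    split_ifs with h
    · subst h
      rw [I.ideal_zero]
      exact Submodule.mem_top
    · exact Ideal.zero_mem _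

/-- The analytic spread `ℓ(I) = dim R[I] / m_R R[I]` of a filtration on a local ring. -/
noncomputable def analyticSpread [IsLocalRing R] (I : IdealFiltration R) : WithBot ℕ∞ :=
  ringKrullDim (I.rees ⧸ (IsLocalRing.maximalIdeal R).map (algebraMap R I.rees))

end IdealFiltration

/-- `x` is integral over the ideal `I`: it satisfies an equation
`xⁿ + c₁ xⁿ⁻¹ + ⋯ + cₙ = 0` with `n ≥ 1` and `cᵢ ∈ Iⁱ`. -/
def IsIntegralOverIdeal {R : Type*} [CommRing R] (I : Ideal R) (x : R) : Prop :=
  ∃ (n : ℕ) (c : ℕ → R), 1 ≤ n ∧ (∀ i ∈ Finset.Icc 1 n, c i ∈ I ^ i) ∧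
    x ^ n + ∑ i ∈ Finset.Icc 1 n, c i * x ^ (n - i) = 0

section Valuations

variable (R : Type*) {K : Type*} [CommRing R] [Field K] [Algebra R K]

/-- The inclusion `R → O` into a valuation ring of `K` that contains the image of `R`. -/
def toValuationRing (O : ValuationSubring K) (h : ∀ x : R, algebraMap R K x ∈ O) : R →+* O :=
  (algebraMap R K).codRestrict O.toSubring h

/-- The center `m_O ∩ R` on `R` of a valuation ring `O` that contains `R`. -/
def valuationCenter (O : ValuationSubring K) (h : ∀ x : R, algebraMap R K x ∈ O) : Ideal R :=
  (IsLocalRing.maximalIdeal O).comap (toValuationRing R O h)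

instance (O : ValuationSubring K) (h : ∀ x : R, algebraMap R K x ∈ O) :
    (valuationCenter R O h).IsPrime :=
  Ideal.IsPrime.comap _

/-- The inclusion `κ(p) → κ(O)` of residue fields induced by `R → O`, where `p` is the center
of `O` on `R`. -/
noncomputable def valuationResidueMap (O : ValuationSubring K)
    (h : ∀ x : R, algebraMap R K x ∈ O) :
    (valuationCenter R O h).ResidueField →+* IsLocalRing.ResidueField O :=
  Ideal.ResidueField.lift (valuationCenter R O h)
    ((IsLocalRing.residue O).comp (toValuationRing R O h))
    (fun x hx => by
      rw [RingHom.mem_ker, RingHom.comp_apply]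
      exact (IsLocalRing.residue_eq_zero_iff _).mpr hx)
    (fun x hx => by
      rw [Submonoid.mem_comap]
      refine (isUnit_iff_ne_zero.mpr fun h0 => hx ?_)
      exact (IsLocalRing.residue_eq_zero_iff _).mp h0)

/-- The transcendence degree of `κ(O)` over `κ(p)`, where `p` is the center of `O` on `R`
(`⊤` if it is infinite). -/
noncomputable def valuationResidueTrdeg (O : ValuationSubring K)
    (h : ∀ x : R, algebraMap R K x ∈ O) : ℕ∞ :=
  letI := (valuationResidueMap R O h).toAlgebra
  Cardinal.toENat
    (Algebra.trdeg (valuationCenter R O h).ResidueField (IsLocalRing.ResidueField O))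

variable (K)

/-- A divisorial valuation of a domain `R` with quotient field `K`, given by its valuation ring:
a valuation ring of `K` that contains `R` and, with `p` its center on `R`, satisfies
`trdeg_{κ(p)} κ(O) = ht p - 1`. -/
structure DivisorialValuation where
  valuationRing : ValuationSubring K
  algebraMap_mem : ∀ x : R, algebraMap R K x ∈ valuationRing
  trdeg_add_one : valuationResidueTrdeg R valuationRing algebraMap_mem + 1 =
    (valuationCenter R valuationRing algebraMap_mem).height

namespace DivisorialValuation

variable {R K}

/-- The center `m_ν ∩ R` of `ν` on `R`. -/
def center (ν : DivisorialValuation R K) : Ideal R :=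
  valuationCenter R ν.valuationRing ν.algebraMap_mem

/-- The valuation ideal `I(ν)ₙ = {f ∈ R | ν(f) ≥ n} = m_νⁿ ∩ R`. -/
def valuationIdeal (ν : DivisorialValuation R K) (n : ℕ) : Ideal R :=
  (IsLocalRing.maximalIdeal ν.valuationRing ^ n).comap
    (toValuationRing R ν.valuationRing ν.algebraMap_mem)

end DivisorialValuation

end Valuations

/-! Split the valuations by whether their center is `m_R`. If those with smaller center already cut
out every `I_n`, prime avoidance gives `x ∈ m_R` outside their centers, a nonzerodivisor modulo
every `I_n`, and `analyticSpread_lt_ringKrullDim` contradicts `ℓ(I) = dim R`. So at some level `n`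
an element `f` meets all conditions from smaller centers but fails at some `ν_j` centered at `m_R`.
For large `m`, a suitable power of `f` behaves likewise at level `m`, and a power of `m_R`
multiplies it into `I_m`; hence `m_R` is associated.

For the bound on the spread, a chain of length `d = dim R` in the fiber ring yields `d` monomials
`c_i t^{e_i}` algebraically independent over the residue field modulo a prime `P` of the Rees
algebra containing `m_R`. Since `x ∈ P`, `P` contains the contraction of `q[t]` for some nonzero
prime `q`. The relations between the monomials modulo `q[t]` form a prime of `R[X_1, …, X_d]` of
height at least `d`, strictly inside `m_R R[X]`, whose height is at most `d`: a contradiction.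

Integral closedness is inherited from the valuation rings. -/

/-! ### Chains of primes and algebraic independence. -/

/-- Over a strictly increasing chain `p₀ < p₁ < ⋯ < pₙ` of primes in an algebra over a field, there
are `n` elements that are algebraically independent modulo `p₀`. -/
theorem exists_algebraicIndependent_mk_of_strictMono {k F : Type*} [Field k] [CommRing F]
    [Algebra k F] : ∀ (n : ℕ) (p : Fin (n + 1) → PrimeSpectrum F), StrictMono p →
      ∃ y : Fin n → F ⧸ (p 0).asIdeal, AlgebraicIndependent k y
  | 0, p, _ => ⟨Fin.elim0, by
      rw [algebraicIndependent_empty_type_iff]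
      exact FaithfulSMul.algebraMap_injective k _⟩
  | n + 1, p, hp => by
    obtain ⟨z, hz⟩ := exists_algebraicIndependent_mk_of_strictMono (k := k) n (p ∘ Fin.succ)
      (hp.comp (Fin.strictMono_succ))
    have hlt : p 0 < p (Fin.succ 0) := hp (Fin.succ_pos 0)
    have hle : (p 0).asIdeal ≤ (p (Fin.succ 0)).asIdeal := hlt.le
    obtain ⟨a, ha1, ha0⟩ := SetLike.exists_of_lt (show (p 0).asIdeal < _ from hlt)
    let g : F ⧸ (p 0).asIdeal →ₐ[k] F ⧸ (p (Fin.succ 0)).asIdeal := Ideal.Quotient.factorₐ k hle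
    have hg : Function.Surjective g := Ideal.Quotient.factor_surjective hle
    choose y hy using fun i => hg (z i)
    have hgy : AlgebraicIndependent k (g ∘ y) := by
      rw [show g ∘ y = z from funext hy]; exact hz
    have hyi : AlgebraicIndependent k y := hgy.of_comp g
    let b : F ⧸ (p 0).asIdeal := Ideal.Quotient.mk _ a
    have hb0 : b ≠ 0 := fun h => ha0 (Ideal.Quotient.eq_zero_iff_mem.mp h)
    have hgb : g b = 0 := Ideal.Quotient.eq_zero_iff_mem.mpr ha1
    -- A relation for `b` over `k[y]` may be taken with nonzero constant coefficient. As `g` kills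
    -- `b`, it kills that coefficient, contradicting the independence of the images of `y`.
    have htr : Transcendental (Algebra.adjoin k (Set.range y)) b := by
      intro halg
      obtain ⟨q, hq0, hq⟩ :=
        halg.exists_nonzero_coeff_and_aeval_eq_zero (mem_nonZeroDivisors_of_ne_zero hb0)
      apply hq0
      have h1 : g (q.coeff 0 : F ⧸ (p 0).asIdeal) = 0 := by
        have h2 := congrArg g hq
        rw [← Polynomial.divX_mul_X_add q, map_add, map_mul, Polynomial.aeval_X, Polynomial.aeval_C,
          map_add, map_mul, hgb, mul_zero, zero_add, map_zero] at h2
        exact h2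
      obtain ⟨G, hG⟩ := (Algebra.adjoin_range_eq_range_aeval k y).le (q.coeff 0).2
      have hG' : MvPolynomial.aeval y G = (q.coeff 0 : F ⧸ (p 0).asIdeal) := hG
      have hG0 : G = 0 := by
        apply hgy
        rw [map_zero, ← h1, ← hG', MvPolynomial.comp_aeval_apply]
        rfl
      apply Subtype.ext
      rw [← hG', hG0, map_zero]
      rfl
    have := (hyi.option_iff_transcendental b).mpr htr
    exact ⟨_, (algebraicIndependent_equiv (finSuccEquiv n)).mpr this⟩

/-! ### Heights of kernels of polynomial evaluations. -/

section Chain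

open MvPolynomial

variable {R D σ : Type*} [CommRing R] [CommRing D]

/-- The height formula over `p` bounds the left side by `ht p` plus the height of the extended ideal
modulo itself, which is zero. -/
theorem height_map_C_le [IsNoetherianRing R] [Finite σ] (p : Ideal R) [p.IsPrime] :
    (p.map (C : R →+* MvPolynomial σ R)).height ≤ p.height := by
  have hk : p.map (C : R →+* MvPolynomial σ R) = RingHom.ker (map (Ideal.Quotient.mk p)) := by
    rw [ker_map, Ideal.mk_ker]
  have : (p.map (C : R →+* MvPolynomial σ R)).IsPrime := by
    rw [hk]; exact RingHom.ker_isPrime _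
  have : (p.map (C : R →+* MvPolynomial σ R)).LiesOver p := ⟨by
    ext x
    rw [Ideal.mem_comap, hk, RingHom.mem_ker, algebraMap_eq, map_C, C_eq_zero,
      Ideal.Quotient.eq_zero_iff_mem]⟩
  refine (Ideal.height_le_height_add_of_liesOver p _).trans ?_
  rw [algebraMap_eq, Ideal.map_quotient_self, Ideal.height_bot, add_zero]

variable [DecidableEq σ]

/-- The evaluation of `R[X_i]` in `D[X_i]` that sends `X_i` to `y_i` for `i ∈ s` and fixes the
other variables. -/
noncomputable def partialEval (f : R →+* D) (y : σ → D) (s : Finset σ) :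
    MvPolynomial σ R →+* MvPolynomial σ D :=
  eval₂Hom (C.comp f) fun i => if i ∈ s then C (y i) else X i

/-- Evaluation on `t` factors through evaluation on `s`. -/
theorem partialEval_mono (f : R →+* D) (y : σ → D) {s t : Finset σ} (h : s ⊆ t) :
    RingHom.ker (partialEval f y s) ≤ RingHom.ker (partialEval f y t) := by
  have : (partialEval (RingHom.id D) y t).comp (partialEval f y s) = partialEval f y t := by
    apply MvPolynomial.ringHom_ext
    · intro r; simp [partialEval]
    · intro i
      by_cases hi : i ∈ s
      · simp [partialEval, hi, h hi]
      · simp [partialEval, hi]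
  rw [← this, ← RingHom.comap_ker]
  exact Ideal.comap_mono bot_le

theorem partialEval_univ [Fintype σ] (f : R →+* D) (y : σ → D) :
    partialEval f y Finset.univ = C.comp (eval₂Hom f y) := by
  apply MvPolynomial.ringHom_ext <;> intro i <;> simp [partialEval]

/-- If `D` is a domain and `y_i` is algebraically dependent on `y_{i₀}` through a binomial relation
for each `i`, then the kernel of the evaluation at `y` on a subset of the variables has the expected
height. -/
theorem card_add_one_le_height_ker_partialEval [IsDomain R] [IsDomain D] (f : R →+* D)
    (hf : ¬ Function.Injective f) (y : σ → D) (i₀ : σ) (c : σ → R) (e : σ → ℕ)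
    (hc : ∀ i, f (c i) ≠ 0) (he : ∀ i, e i ≠ 0)
    (hrel : ∀ i, f (c i₀ ^ e i) * y i ^ e i₀ = f (c i ^ e i₀) * y i₀ ^ e i)
    (s : Finset σ) (hs : i₀ ∉ s) :
    (s.card + 1 : ℕ) ≤ (RingHom.ker (partialEval f y (insert i₀ s))).height := by
  have hprime (t : Finset σ) : (RingHom.ker (partialEval f y t)).IsPrime := RingHom.ker_isPrime _
  induction s using Finset.induction_on with
  | empty =>
    have hlt : (⊥ : Ideal (MvPolynomial σ R)) <
        RingHom.ker (partialEval f y (insert i₀ ∅)) := by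
      rw [bot_lt_iff_ne_bot]
      intro h
      rw [← RingHom.injective_iff_ker_eq_bot] at h
      apply hf
      intro a b hab
      apply MvPolynomial.C_injective σ R
      apply h
      simp [partialEval, hab]
    simpa using Ideal.height_add_one_le_of_lt_of_isPrime hlt
  | insert j s hj ih =>
    have hij : i₀ ≠ j := fun h => hs (h ▸ Finset.mem_insert_self _ _)
    have hlt : RingHom.ker (partialEval f y (insert i₀ s)) <
        RingHom.ker (partialEval f y (insert i₀ (insert j s))) := by
      refine lt_of_le_of_ne (partialEval_mono _ _
        (Finset.insert_subset_insert _ (Finset.subset_insert _ _))) fun h => ?_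
      -- This binomial dies once `X_j` is evaluated too; before that, its coefficient at `X_j ^ e
      -- i₀` is a power of `f (c i₀)`, hence nonzero.
      let G : MvPolynomial σ R := C (c i₀ ^ e j) * X j ^ e i₀ - C (c j ^ e i₀) * X i₀ ^ e j
      have h1 : G ∈ RingHom.ker (partialEval f y (insert i₀ (insert j s))) := by
        have := congrArg (C (σ := σ)) (hrel j)
        simp only [map_mul, map_pow] at this
        simp [G, partialEval, RingHom.mem_ker, this]
      rw [← h, RingHom.mem_ker] at h1
      have h2 : partialEval f y (insert i₀ s) G = C (f (c i₀ ^ e j)) * X j ^ e i₀ -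
          C (f (c j ^ e i₀) * y i₀ ^ e j) := by
        simp [G, partialEval, hj, hij.symm]
      have h3 : (0 : σ →₀ ℕ) ≠ Finsupp.single j (e i₀) := by
        rw [ne_comm, Finsupp.single_ne_zero]
        exact he i₀
      have h4 := congrArg (coeff (Finsupp.single j (e i₀))) (h2.symm.trans h1)
      rw [coeff_sub, coeff_C_mul, coeff_X_pow, if_pos rfl, coeff_C, if_neg h3, mul_one, sub_zero,
        coeff_zero, map_pow] at h4
      exact hc i₀ (pow_eq_zero_iff (he j) |>.mp h4)
    have := Ideal.height_add_one_le_of_lt_of_isPrime hlt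
    rw [Finset.card_insert_of_notMem hj]
    refine le_trans ?_ this
    have := ih fun h => hs (Finset.mem_insert_of_mem h)
    push_cast at this ⊢
    gcongr

end Chain

/-- Let `q` be a nonzero prime of a Noetherian local domain `R` and let `cᵢ tᵉⁱ` be monomials with
`cᵢ ∈ m_R \ q` such that each polynomial relation between them modulo `q[t]` has coefficients in
`m_R`. Then there are fewer than `ht m_R` of them. -/
theorem card_add_one_le_height_of_monomial_relations {R σ : Type*} [CommRing R] [IsDomain R]
    [IsNoetherianRing R] [Fintype σ] [Nonempty σ] (m q : Ideal R) [m.IsPrime] [q.IsPrime]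
    (hq : q ≠ ⊥) (c : σ → R) (e : σ → ℕ) (hcm : ∀ i, c i ∈ m) (hcq : ∀ i, c i ∉ q)
    (he : ∀ i, e i ≠ 0)
    (H : ∀ G : MvPolynomial σ R,
      MvPolynomial.eval₂Hom (Polynomial.C.comp (Ideal.Quotient.mk q))
        (fun i => Polynomial.monomial (e i) (Ideal.Quotient.mk q (c i))) G = 0 →
      G ∈ m.map MvPolynomial.C) :
    (Fintype.card σ + 1 : ℕ) ≤ m.height := by
  classical
  obtain ⟨i₀⟩ := ‹Nonempty σ›
  set f : R →+* Polynomial (R ⧸ q) := Polynomial.C.comp (Ideal.Quotient.mk q) with hf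
  set y : σ → Polynomial (R ⧸ q) :=
    fun i => Polynomial.monomial (e i) (Ideal.Quotient.mk q (c i)) with hy
  have hcard : (Finset.univ.erase i₀ : Finset σ).card + 1 = Fintype.card σ :=
    Finset.card_erase_add_one (Finset.mem_univ _)
  have key := card_add_one_le_height_ker_partialEval f (fun hinj => hq (by
      have hk : RingHom.ker f = ⊥ := (RingHom.injective_iff_ker_eq_bot f).mp hinj
      rw [eq_bot_iff, ← hk]
      intro r hr
      rw [RingHom.mem_ker, hf, RingHom.comp_apply, Ideal.Quotient.eq_zero_iff_mem.mpr hr,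
        map_zero])) y i₀ c e
    (fun i => by
      rw [hf, RingHom.comp_apply, Ne, Polynomial.C_eq_zero, Ideal.Quotient.eq_zero_iff_mem]
      exact hcq i) he
    (fun i => by
      simp only [hf, hy, RingHom.comp_apply, Polynomial.monomial_pow, Polynomial.C_mul_monomial,
        ← map_pow, ← map_mul]
      rw [mul_comm (c i₀ ^ e i), mul_comm (e i)])
    (Finset.univ.erase i₀) (Finset.notMem_erase _ _)
  rw [Finset.insert_erase (Finset.mem_univ _), hcard] at key
  have hker : ∀ G, G ∈ RingHom.ker (partialEval f y Finset.univ) ↔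
      MvPolynomial.eval₂Hom f y G = 0 := fun G => by
    rw [partialEval_univ, RingHom.mem_ker, RingHom.comp_apply, MvPolynomial.C_eq_zero]
  have hmp : (m.map (MvPolynomial.C : R →+* MvPolynomial σ R)).IsPrime := by
    have hk : m.map (MvPolynomial.C : R →+* MvPolynomial σ R) =
        RingHom.ker (MvPolynomial.map (Ideal.Quotient.mk m)) := by
      rw [MvPolynomial.ker_map, Ideal.mk_ker]
    rw [hk]; exact RingHom.ker_isPrime _
  -- The constant `c i₀`, in `m` but not in `q`, makes the inclusion strict and supplies the extra
  -- one in the height.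
  have hlt : RingHom.ker (partialEval f y Finset.univ) <
      m.map (MvPolynomial.C : R →+* MvPolynomial σ R) := by
    refine lt_of_le_of_ne (fun G hG => H G ((hker G).mp hG)) fun h => ?_
    have h1 := Ideal.mem_map_of_mem (MvPolynomial.C : R →+* MvPolynomial σ R) (hcm i₀)
    rw [← h, hker, MvPolynomial.coe_eval₂Hom, MvPolynomial.eval₂_C, hf, RingHom.comp_apply,
      Polynomial.C_eq_zero, Ideal.Quotient.eq_zero_iff_mem] at h1
    exact hcq i₀ h1
  have hprime : (RingHom.ker (partialEval f y Finset.univ)).IsPrime := RingHom.ker_isPrime _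
  refine le_trans ?_ ((Ideal.height_add_one_le_of_lt_of_isPrime hlt).trans (height_map_C_le m))
  push_cast at key ⊢
  gcongr

/-- If a domain `A` over a field `k` is generated as an additive monoid by `S` and contains `n`
algebraically independent elements, then so does `S`. -/
theorem exists_algebraicIndependent_of_closure_eq_top {k A : Type*} [Field k] [CommRing A]
    [IsDomain A] [Algebra k A] (S : Set A) (hS : AddSubmonoid.closure S = ⊤) {n : ℕ}
    {y : Fin n → A} (hy : AlgebraicIndependent k y) :
    ∃ z : Fin n → A, (∀ i, z i ∈ S) ∧ AlgebraicIndependent k z := by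
  have hadj : Algebra.adjoin k S = ⊤ := by
    rw [eq_top_iff]
    intro a _
    have ha : a ∈ AddSubmonoid.closure S := by rw [hS]; trivial
    exact (AddSubmonoid.closure_le (S := (Algebra.adjoin k S).toSubmodule.toAddSubmonoid)).mpr
      Algebra.subset_adjoin ha
  have : Algebra.IsAlgebraic (Algebra.adjoin k S) A :=
    ⟨fun a => isAlgebraic_algebraMap (⟨a, hadj ▸ Algebra.mem_top⟩ : Algebra.adjoin k S)⟩
  obtain ⟨t, htS, ht⟩ := exists_isTranscendenceBasis_subset (R := k) S
  have hcard := hy.lift_cardinalMk_le_trdeg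
  rw [← ht.cardinalMk_eq_trdeg] at hcard
  obtain ⟨g⟩ := Cardinal.lift_mk_le'.mp hcard
  exact ⟨fun i => g i, fun i => htS (g i).2, ht.1.comp g g.injective⟩

/-! ### The Rees algebra and the bound on the analytic spread. -/

namespace IdealFiltration

open Polynomial

variable {R : Type*} [CommRing R] (I : IdealFiltration R)

/-- The homogeneous element `a tⁿ` of the Rees algebra, for `a ∈ Iₙ`. -/
noncomputable def reesMonomial (n : ℕ) (a : I.ideal n) : I.rees :=
  ⟨monomial n (a : R), fun k => by
    rw [coeff_monomial]
    split_ifs with h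
    · exact h ▸ a.2
    · exact Ideal.zero_mem _⟩

theorem closure_reesMonomial :
    AddSubmonoid.closure (Set.range fun p : Σ n, I.ideal n => I.reesMonomial p.1 p.2) = ⊤ := by
  rw [eq_top_iff]
  intro g _
  have hg : g = ∑ n ∈ (g : R[X]).support, I.reesMonomial n ⟨(g : R[X]).coeff n, g.2 n⟩ := by
    apply Subtype.ext
    rw [AddSubmonoidClass.coe_finsetSum]
    exact (g : R[X]).as_sum_support
  rw [hg]
  exact sum_mem fun n _ => AddSubmonoid.subset_closure ⟨⟨n, _, _⟩, rfl⟩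

/-- If `x` is a nonzerodivisor modulo each `Iₙ`, then each prime of the Rees algebra that contains
`x` contains the contraction of `q[t]` for a prime `q` of `R` that contains `x`. -/
theorem exists_prime_of_mem (x : R) (hx : ∀ n f, x * f ∈ I.ideal n → f ∈ I.ideal n)
    (P : Ideal I.rees) [P.IsPrime] (hxP : algebraMap R I.rees x ∈ P) :
    ∃ q : Ideal R, q.IsPrime ∧ x ∈ q ∧
      ∀ g : I.rees, (g : R[X]).map (Ideal.Quotient.mk q) = 0 → g ∈ P := by
  -- Division by `x` preserves the Rees algebra, so `x R[t]` contracts to multiples of `x` there.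
  have hle : (Ideal.span {(C x : R[X])}).comap I.rees.val.toRingHom ≤ P := by
    intro g hg
    obtain ⟨h, hh⟩ := Ideal.mem_span_singleton.mp (Ideal.mem_comap.mp hg)
    have hh' : (g : R[X]) = C x * h := hh
    have hmem : h ∈ I.rees := fun n => hx n _ (by
      rw [← coeff_C_mul, ← hh']
      exact g.2 n)
    have : g = algebraMap R I.rees x * ⟨h, hmem⟩ := Subtype.ext hh'
    rw [this]
    exact P.mul_mem_right _ hxP
  obtain ⟨Q, hQ, hQP⟩ := Ideal.exists_minimalPrimes_le hle
  -- A minimal prime over a contracted ideal is itself contracted, here from a prime `p` of `R[t]`;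
  -- take `q = p ∩ R`.
  obtain ⟨p, hp, hxp, hpQ⟩ := Ideal.exists_comap_eq_of_mem_minimalPrimes _ _ hQ
  refine ⟨p.comap C, Ideal.comap_isPrime _ _, hxp (Ideal.mem_span_singleton_self _), ?_⟩
  intro g hg
  apply hQP
  rw [← hpQ]
  have hg' : (g : R[X]) ∈ (p.comap C).map C := by
    rw [← Ideal.mk_ker (I := p.comap C), ← ker_mapRingHom]
    exact hg
  exact show (g : R[X]) ∈ p from Ideal.map_comap_le hg'

/-- Let `k` be a residue field of a Noetherian domain `R` at a prime `m` that contains each `Iₙ`,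
`n ≥ 1`, and a nonzero `x` that is a nonzerodivisor modulo each `Iₙ`. Then chains of primes in a
quotient of the Rees algebra that is a `k`-algebra compatibly with `R → k` are shorter than `ht m`. -/
theorem length_add_one_le_height {k F : Type*} [IsDomain R] [IsNoetherianRing R] [Field k]
    [CommRing F] (g : k →+* F) (f : R →+* k) (h1 : I.ideal 1 ≤ RingHom.ker f) (x : R) (hx0 : x ≠ 0)
    (hxm : x ∈ RingHom.ker f) (hx : ∀ n g, x * g ∈ I.ideal n → g ∈ I.ideal n)
    (ρ : I.rees →+* F) (hρ : Function.Surjective ρ)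
    (hρa : ∀ r, ρ (algebraMap R I.rees r) = g (f r))
    (l : LTSeries (PrimeSpectrum F)) (hpos : l.length ≠ 0) :
    (l.length + 1 : ℕ) ≤ (RingHom.ker f).height := by
  let := g.toAlgebra
  have hkerf : (RingHom.ker f).IsPrime := RingHom.ker_isPrime _
  have : Nonempty (Fin l.length) := ⟨⟨0, Nat.pos_of_ne_zero hpos⟩⟩
  obtain ⟨y, hy⟩ := exists_algebraicIndependent_mk_of_strictMono (k := k)
    l.length l.toFun l.strictMono
  let P₀ := (l.toFun 0).asIdeal
  let π : I.rees →+* F ⧸ P₀ := (Ideal.Quotient.mk P₀).comp ρ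
  have hπ : Function.Surjective π := Ideal.Quotient.mk_surjective.comp hρ
  have hπa (r : R) : π (algebraMap R I.rees r) =
      algebraMap k (F ⧸ P₀) (f r) :=
    congrArg (Ideal.Quotient.mk P₀) (hρa r)
  obtain ⟨z, hzS, hz⟩ := exists_algebraicIndependent_of_closure_eq_top
    (Set.range fun p : Σ n, I.ideal n => π (I.reesMonomial p.1 p.2)) (by
      rw [show (fun p : Σ n, I.ideal n => π (I.reesMonomial p.1 p.2)) =
        π ∘ fun p => I.reesMonomial p.1 p.2 from rfl, Set.range_comp]
      have := AddMonoidHom.map_mclosure π.toAddMonoidHom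
        (Set.range fun p : Σ n, I.ideal n => I.reesMonomial p.1 p.2)
      rw [closure_reesMonomial, ← AddMonoidHom.mrange_eq_map,
        show AddMonoidHom.mrange π.toAddMonoidHom = ⊤ from
          AddMonoidHom.mrange_eq_top_of_surjective _ hπ] at this
      exact this.symm) hy
  choose p hp using hzS
  have hkerπ : (RingHom.ker π).IsPrime := RingHom.ker_isPrime _
  obtain ⟨q, hq, hxq, hqP⟩ := I.exists_prime_of_mem x hx (RingHom.ker π) (by
    rw [RingHom.mem_ker, hπa, RingHom.mem_ker.mp hxm, map_zero])
  have hmono (i) : ((I.reesMonomial (p i).1 (p i).2 : I.rees) : R[X]).map (Ideal.Quotient.mk q) =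
      monomial (p i).1 (Ideal.Quotient.mk q ((p i).2 : R)) := by
    rw [reesMonomial, map_monomial]
  -- A monomial of degree zero maps to a scalar, which is not transcendental over `k`.
  have he (i) : (p i).1 ≠ 0 := by
    intro h0
    have hc : I.reesMonomial (p i).1 (p i).2 = algebraMap R I.rees ((p i).2 : R) := by
      apply Subtype.ext
      change monomial (p i).1 _ = C _
      rw [← monomial_zero_left]
      exact congrArg (fun j => monomial j ((p i).2 : R)) h0
    have htr := hz.transcendental i
    rw [← hp i] at htr
    apply htr
    simp only [hc, hπa]
    exact isAlgebraic_algebraMap _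
  have key := card_add_one_le_height_of_monomial_relations (RingHom.ker f) q
    (fun h => hx0 (by rw [h] at hxq; exact hxq)) (fun i => ((p i).2 : R)) (fun i => (p i).1)
    (fun i => h1 (I.antitone (Nat.one_le_iff_ne_zero.mpr (he i)) (p i).2.2))
    (fun i hi => hz.ne_zero i (by
      rw [← hp i]
      refine RingHom.mem_ker.mp (hqP _ ?_)
      rw [hmono, Ideal.Quotient.eq_zero_iff_mem.mpr hi, map_zero])) he (fun G hG => by
      -- A relation modulo `q[t]` becomes a relation between the `z i` over `k`; independence forces
      -- all its coefficients into `ker f`.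
      have hG1 : MvPolynomial.eval₂Hom (algebraMap R I.rees)
          (fun i => I.reesMonomial (p i).1 (p i).2) G ∈ RingHom.ker π := by
        apply hqP
        rw [← hG]
        let ψ : I.rees →+* (R ⧸ q)[X] :=
          (mapRingHom (Ideal.Quotient.mk q)).comp I.rees.val.toRingHom
        change ψ _ = _
        rw [← RingHom.comp_apply]
        congr 1
        apply MvPolynomial.ringHom_ext
        · intro r
          simp only [RingHom.comp_apply, MvPolynomial.coe_eval₂Hom, MvPolynomial.eval₂_C]
          exact map_C _
        · intro i
          simp only [RingHom.comp_apply, MvPolynomial.coe_eval₂Hom, MvPolynomial.eval₂_X]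
          exact hmono i
      have hG2 : MvPolynomial.aeval z (MvPolynomial.map f G) =
          0 := by
        rw [← RingHom.mem_ker.mp hG1, MvPolynomial.aeval_def, MvPolynomial.eval₂_map,
          ← MvPolynomial.coe_eval₂Hom, ← RingHom.comp_apply]
        congr 1
        apply MvPolynomial.ringHom_ext
        · intro r
          simp only [RingHom.comp_apply, MvPolynomial.coe_eval₂Hom, MvPolynomial.eval₂_C]
          exact (hπa r).symm
        · intro i
          simp only [RingHom.comp_apply, MvPolynomial.coe_eval₂Hom, MvPolynomial.eval₂_X]
          exact (hp i).symm
      have hG3 := hz (hG2.trans (map_zero _).symm)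
      rw [← MvPolynomial.ker_map]
      exact hG3)
  rwa [Fintype.card_fin] at key

open IsLocalRing in
/-- The analytic spread of a filtration by proper ideals on a Noetherian local domain is less than
the dimension if some nonzero `x ∈ m_R` is a nonzerodivisor modulo each `Iₙ`. -/
theorem analyticSpread_lt_ringKrullDim [IsDomain R] [IsLocalRing R] [IsNoetherianRing R]
    (h1 : I.ideal 1 ≠ ⊤) (x : R) (hx0 : x ≠ 0) (hxm : x ∈ maximalIdeal R)
    (hx : ∀ n f, x * f ∈ I.ideal n → f ∈ I.ideal n) :
    I.analyticSpread < ringKrullDim R := by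
  by_contra! hcon
  obtain ⟨J, hJ, hcon⟩ : ∃ J : Ideal I.rees,
      (∀ r ∈ maximalIdeal R, algebraMap R I.rees r ∈ J) ∧
      ringKrullDim R ≤ ringKrullDim (I.rees ⧸ J) :=
    ⟨_, fun r hr => Ideal.mem_map_of_mem _ hr, hcon⟩
  have hfin : (maximalIdeal R).height ≠ ⊤ := Ideal.height_ne_top Ideal.IsPrime.ne_top'
  obtain ⟨d, hd⟩ := ENat.ne_top_iff_exists.mp hfin
  have hdim : ringKrullDim R = (d : WithBot ℕ∞) := by
    rw [← maximalIdeal_height_eq_ringKrullDim, ← hd]; rfl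
  rw [hdim, ringKrullDim, Order.le_krullDim_iff] at hcon
  obtain ⟨l, rfl⟩ := hcon
  -- The nonzero `x ∈ m_R` makes the dimension of `R` positive.
  have hpos : l.length ≠ 0 := by
    intro h0
    have hlt : (⊥ : Ideal R) < maximalIdeal R := by
      rw [bot_lt_iff_ne_bot]
      intro h
      rw [h] at hxm
      exact hx0 hxm
    have := Ideal.height_add_one_le_of_lt_of_isPrime hlt
    rw [← hd, h0] at this
    simp at this
  have hk : RingHom.ker (residue R) = maximalIdeal R := ker_residue
  have hs : Function.Surjective (Ideal.Quotient.mk J) := Ideal.Quotient.mk_surjective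
  let g : ResidueField R →+* I.rees ⧸ J :=
    Ideal.Quotient.lift (maximalIdeal R) ((Ideal.Quotient.mk J).comp (algebraMap R I.rees))
      fun r hr => Ideal.Quotient.eq_zero_iff_mem.mpr (hJ r hr)
  have hg (r : R) : Ideal.Quotient.mk J (algebraMap R I.rees r) = g (residue R r) := rfl
  have key := I.length_add_one_le_height (F := I.rees ⧸ J) g (residue R)
    (by rw [hk]; exact le_maximalIdeal h1) x hx0 (by rw [hk]; exact hxm) hx
    (Ideal.Quotient.mk J) hs hg l hpos
  rw [hk, ← hd, Nat.cast_le] at key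
  omega

end IdealFiltration

/-! ### Integral closure and powers of the maximal ideal in valuation rings. -/

section ValuationRing

variable {O : Type*} [CommRing O] [IsDomain O] [ValuationRing O]

/-- In a valuation ring each ideal is integrally closed. -/
theorem IsIntegralOverIdeal.mem_of_valuationRing {J : Ideal O} {x : O}
    (h : IsIntegralOverIdeal J x) : x ∈ J := by
  obtain ⟨n, c, hn, hc, heq⟩ := h
  by_contra hx
  have hx0 : x ≠ 0 := fun h0 => hx (h0 ▸ J.zero_mem)
  -- If `x ∉ J`, every element of `J` is a proper multiple of `x`; the integral equation then puts
  -- `x ^ n` in `x ^ n m`.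
  have hJ : J ≤ Ideal.span {x} * IsLocalRing.maximalIdeal O := by
    intro y hy
    rw [Ideal.mem_span_singleton_mul]
    rcases ValuationRing.dvd_total x y with ⟨z, rfl⟩ | ⟨z, rfl⟩
    · refine ⟨z, ?_, rfl⟩
      by_contra hz
      have hu : IsUnit z := by simpa using hz
      exact hx ((Ideal.mul_unit_mem_iff_mem J hu).mp hy)
    · exact absurd (J.mul_mem_right _ hy) hx
  have hterm : ∀ i ∈ Finset.Icc 1 n,
      c i * x ^ (n - i) ∈ Ideal.span {x ^ n} * IsLocalRing.maximalIdeal O := by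
    intro i hi
    obtain ⟨hi1, hin⟩ := Finset.mem_Icc.mp hi
    have h1 : c i ∈ Ideal.span {x ^ i} * IsLocalRing.maximalIdeal O := by
      have h2 := Ideal.pow_right_mono hJ i (hc i hi)
      rw [mul_pow, Ideal.span_singleton_pow] at h2
      exact Ideal.mul_mono_right (Ideal.pow_le_self (by omega)) h2
    obtain ⟨z, hz, hzc⟩ := Ideal.mem_span_singleton_mul.mp h1
    rw [Ideal.mem_span_singleton_mul]
    refine ⟨z, hz, ?_⟩
    rw [← hzc, ← Nat.add_sub_cancel' hin, pow_add, Nat.add_sub_cancel_left]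
    ring
  have hxn : x ^ n ∈ Ideal.span {x ^ n} * IsLocalRing.maximalIdeal O := by
    have h1 := neg_mem (sum_mem hterm)
    rwa [← eq_neg_of_add_eq_zero_left heq] at h1
  obtain ⟨z, hz, hzx⟩ := Ideal.mem_span_singleton_mul.mp hxn
  have : z = 1 := mul_left_cancel₀ (pow_ne_zero n hx0) (by rw [hzx, mul_one])
  rw [this] at hz
  exact (Ideal.ne_top_iff_one _).mp Ideal.IsPrime.ne_top' hz

open IsLocalRing in
/-- In a valuation ring, `f ∉ m^N` forces `f` to generate some `m^c` with `c < N`. -/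
theorem exists_maximalIdeal_pow_eq_span {f : O} {N : ℕ} (hf : f ∉ maximalIdeal O ^ N) :
    ∃ c < N, maximalIdeal O ^ c = Ideal.span {f} := by
  induction N with
  | zero => simp at hf
  | succ N ih =>
    by_cases h : f ∈ maximalIdeal O ^ N
    · refine ⟨N, N.lt_succ_self, le_antisymm ?_ ((Ideal.span_singleton_le_iff_mem _).mpr h)⟩
      intro y hy
      rw [Ideal.mem_span_singleton]
      rcases ValuationRing.dvd_total f y with hd | ⟨z, rfl⟩
      · exact hd
      · have hz : IsUnit z := by
          by_contra hz
          exact hf (pow_succ (maximalIdeal O) N ▸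
            Ideal.mul_mem_mul hy ((mem_maximalIdeal z).mpr hz))
        exact (hz.dvd_mul_right.mp (dvd_refl _) : y * z ∣ y)
    · obtain ⟨c, hc, h⟩ := ih h
      exact ⟨c, hc.trans N.lt_succ_self, h⟩

-- Some `m^c` with `c ≤ N - 1` is generated by `f`, so `f ^ k` generates `m^(ck)` and cannot lie in
-- `m^(ck+1) = f ^ k m`. Discreteness is not needed.
open IsLocalRing in
theorem pow_notMem_maximalIdeal_pow {f : O} {N : ℕ} (hf0 : f ≠ 0)
    (hf : f ∉ maximalIdeal O ^ N) (k : ℕ) : f ^ k ∉ maximalIdeal O ^ ((N - 1) * k + 1) := by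
  obtain ⟨c, hc, hcf⟩ := exists_maximalIdeal_pow_eq_span hf
  intro hmem
  have h1 : f ^ k ∈ maximalIdeal O ^ (c * k + 1) :=
    Ideal.pow_le_pow_right (by gcongr; omega) hmem
  rw [pow_succ, pow_mul, hcf, Ideal.span_singleton_pow, Ideal.mem_span_singleton_mul] at h1
  obtain ⟨z, hz, hzx⟩ := h1
  have : z = 1 := mul_left_cancel₀ (pow_ne_zero k hf0) (by rw [hzx, mul_one])
  rw [this] at hz
  exact (Ideal.ne_top_iff_one _).mp Ideal.IsPrime.ne_top' hz

end ValuationRing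

section Integral

theorem IsIntegralOverIdeal.map {R S : Type*} [CommRing R] [CommRing S] (φ : R →+* S)
    {I : Ideal R} {J : Ideal S} (hIJ : I ≤ J.comap φ) {x : R} (h : IsIntegralOverIdeal I x) :
    IsIntegralOverIdeal J (φ x) := by
  obtain ⟨n, c, hn, hc, heq⟩ := h
  refine ⟨n, fun i => φ (c i), hn, fun i hi => ?_, ?_⟩
  · exact Ideal.pow_right_mono (Ideal.map_le_iff_le_comap.mpr hIJ) i
      (Ideal.map_pow φ I i ▸ Ideal.mem_map_of_mem φ (hc i hi))
  · simpa using congrArg φ heq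

theorem isIntegralOverIdeal_of_mem {R : Type*} [CommRing R] {I : Ideal R} {x : R} (h : x ∈ I) :
    IsIntegralOverIdeal I x :=
  ⟨1, fun _ => -x, le_rfl, by simpa using h, by simp⟩

end Integral

/-! ### Valuation ideals on `R`. -/

namespace DivisorialValuation

variable {R K : Type*} [CommRing R] [Field K] [Algebra R K] (ν : DivisorialValuation R K)

instance : ν.center.IsPrime := inferInstanceAs (valuationCenter R _ _).IsPrime

theorem mem_center_of_mem_valuationIdeal {n : ℕ} (hn : n ≠ 0) {f : R}
    (hf : f ∈ ν.valuationIdeal n) : f ∈ ν.center :=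
  Ideal.comap_mono (Ideal.pow_le_self hn) hf

theorem valuationIdeal_anti {m n : ℕ} (h : m ≤ n) : ν.valuationIdeal n ≤ ν.valuationIdeal m :=
  Ideal.comap_mono (Ideal.pow_le_pow_right h)

theorem pow_mem_valuationIdeal {m : ℕ} {f : R} (hf : f ∈ ν.valuationIdeal m) (k : ℕ) :
    f ^ k ∈ ν.valuationIdeal (m * k) := by
  rw [valuationIdeal, Ideal.mem_comap, map_pow, pow_mul]
  exact Ideal.pow_mem_pow (Ideal.mem_comap.mp hf) k

theorem center_pow_le_valuationIdeal (n : ℕ) : ν.center ^ n ≤ ν.valuationIdeal n :=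
  Ideal.le_comap_pow _ n

theorem mem_valuationIdeal_of_mul_mem {n : ℕ} {x f : R} (hx : x ∉ ν.center)
    (h : x * f ∈ ν.valuationIdeal n) : f ∈ ν.valuationIdeal n := by
  have hu : IsUnit (toValuationRing R ν.valuationRing ν.algebraMap_mem x) := by
    simpa [center, valuationCenter] using hx
  rw [valuationIdeal, Ideal.mem_comap, map_mul] at h
  exact (Ideal.unit_mul_mem_iff_mem _ hu).mp h

theorem pow_notMem_valuationIdeal {n : ℕ} {f : R} (hf : f ∉ ν.valuationIdeal n)
    (k : ℕ) : f ^ k ∉ ν.valuationIdeal ((n - 1) * k + 1) := by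
  rw [valuationIdeal, Ideal.mem_comap, map_pow]
  refine pow_notMem_maximalIdeal_pow (fun h0 => hf ?_) hf k
  rw [valuationIdeal, Ideal.mem_comap, h0]
  exact Ideal.zero_mem _

theorem mem_valuationIdeal_of_isIntegralOverIdeal {n : ℕ} {I : Ideal R}
    (hI : I ≤ ν.valuationIdeal n) {x : R} (hx : IsIntegralOverIdeal I x) :
    x ∈ ν.valuationIdeal n :=
  (hx.map (toValuationRing R ν.valuationRing ν.algebraMap_mem) hI).mem_of_valuationRing

end DivisorialValuation

/-! ### Associated primes and the theorem. -/

-- An associated prime containing the annihilator of the class of `f` contains a power of `m_R`,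
-- hence is `m_R`.
open IsLocalRing in
theorem maximalIdeal_mem_associatedPrimes_quotient {R : Type*} [CommRing R] [IsLocalRing R]
    [IsNoetherianRing R] {I : Ideal R} {f : R} (hf : f ∉ I) {N : ℕ}
    (h : ∀ x ∈ maximalIdeal R ^ N, x * f ∈ I) :
    maximalIdeal R ∈ associatedPrimes R (R ⧸ I) := by
  have hne : (Ideal.Quotient.mk I f : R ⧸ I) ≠ 0 := fun h0 =>
    hf (Ideal.Quotient.eq_zero_iff_mem.mp h0)
  obtain ⟨P, hP, hle⟩ := exists_le_isAssociatedPrime_of_isNoetherianRing R _ hne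
  have := hP.isPrime
  have hNP : maximalIdeal R ^ N ≤ P := fun x hx => hle (by
    simpa [Submodule.mem_colon_singleton, Algebra.smul_def, ← map_mul,
      Ideal.Quotient.eq_zero_iff_mem] using h x hx)
  have : P = maximalIdeal R := le_antisymm (le_maximalIdeal this.ne_top) (this.le_of_pow_le hNP)
  exact this ▸ hP

theorem mainTheorem3 {R K : Type*} [CommRing R] [IsDomain R] [IsLocalRing R] [IsNoetherianRing R]
    [Field K] [Algebra R K] [IsFractionRing R K]
    (r : ℕ) (hr : 0 < r) (ν : Fin r → DivisorialValuation R K) (a : Fin r → ℕ)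
    (ha : ∀ i, 0 < a i) (I : IdealFiltration R)
    (hI : ∀ n, 1 ≤ n → I.ideal n = ⨅ i, (ν i).valuationIdeal (a i * n))
    (hl : I.analyticSpread = ringKrullDim R) :
    (∃ i, (ν i).center = IsLocalRing.maximalIdeal R) ∧
    (∀ n, 1 ≤ n → {x : R | IsIntegralOverIdeal (I.ideal n) x} = I.ideal n) ∧
    ∃ n₀ : ℕ, 0 < n₀ ∧ ∀ n, n₀ ≤ n →
      IsLocalRing.maximalIdeal R ∈ associatedPrimes R (R ⧸ I.ideal n) := by
  classical
  have hmem : ∀ n, 1 ≤ n → ∀ f, f ∈ I.ideal n ↔ ∀ i, f ∈ (ν i).valuationIdeal (a i * n) := by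
    intro n hn f
    rw [hI n hn, Ideal.mem_iInf]
  have han : ∀ i n, 1 ≤ n → a i * n ≠ 0 := fun i n hn =>
    Nat.mul_ne_zero (ha i).ne' (Nat.one_le_iff_ne_zero.mp hn)
  -- Otherwise the valuations centered at `m_R` are redundant in every `I_n`, and the spread drops
  -- below `dim R`.
  obtain ⟨n, hn, f, hfJ, j, hj, hfj⟩ : ∃ n, 1 ≤ n ∧ ∃ f : R,
      (∀ i, (ν i).center ≠ IsLocalRing.maximalIdeal R → f ∈ (ν i).valuationIdeal (a i * n)) ∧
      ∃ j, (ν j).center = IsLocalRing.maximalIdeal R ∧ f ∉ (ν j).valuationIdeal (a j * n) := by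
    by_contra! hcon
    have h1 : I.ideal 1 ≠ ⊤ := by
      rw [Ideal.ne_top_iff_one, hmem 1 le_rfl]
      exact fun h => (Ideal.ne_top_iff_one _).mp Ideal.IsPrime.ne_top'
        ((ν ⟨0, hr⟩).mem_center_of_mem_valuationIdeal (han _ 1 le_rfl) (h ⟨0, hr⟩))
    have hmem' : ∀ n, 1 ≤ n → ∀ f, (∀ i, (ν i).center ≠ IsLocalRing.maximalIdeal R →
        f ∈ (ν i).valuationIdeal (a i * n)) → f ∈ I.ideal n := by
      intro n hn f hf
      rw [hmem n hn]
      intro i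
      by_cases hi : (ν i).center = IsLocalRing.maximalIdeal R
      · exact hcon n hn f hf i hi
      · exact hf i hi
    obtain ⟨i₁, hi₁⟩ : ∃ i, (ν i).center ≠ IsLocalRing.maximalIdeal R := by
      by_contra! hall
      exact h1 ((Ideal.eq_top_iff_one _).mpr
        (hmem' 1 le_rfl 1 fun i hi => absurd (hall i) hi))
    obtain ⟨x, hxm, hx⟩ : ∃ x ∈ IsLocalRing.maximalIdeal R,
        ∀ i, (ν i).center ≠ IsLocalRing.maximalIdeal R → x ∉ (ν i).center := by
      by_contra! hx
      obtain ⟨i, hi, hle⟩ := (Ideal.subset_union_prime (I := IsLocalRing.maximalIdeal R)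
        (s := Finset.univ.filter fun i => (ν i).center ≠ IsLocalRing.maximalIdeal R)
        (f := fun i => (ν i).center) i₁ i₁ fun i _ _ _ => inferInstance).mp (fun y hy => by
          obtain ⟨i, hi, hyi⟩ := hx y hy
          simp only [Set.mem_iUnion]
          exact ⟨i, by simpa using hi, hyi⟩)
      exact (Finset.mem_filter.mp hi).2
        (le_antisymm (IsLocalRing.le_maximalIdeal Ideal.IsPrime.ne_top') hle)
    refine (I.analyticSpread_lt_ringKrullDim h1 x (fun h0 => hx i₁ hi₁ (h0 ▸ zero_mem _)) hxm
      fun n g hg => ?_).ne hl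
    rcases Nat.eq_zero_or_pos n with rfl | hn
    · rw [I.ideal_zero]; trivial
    · exact hmem' n hn g fun i hi =>
        (ν i).mem_valuationIdeal_of_mul_mem (hx i hi) ((hmem n hn _).mp hg i)
  refine ⟨⟨j, hj⟩, fun k hk => Set.ext fun x => ⟨fun hx => ?_, isIntegralOverIdeal_of_mem⟩, ?_⟩
  · exact (hmem k hk x).mpr fun i => (ν i).mem_valuationIdeal_of_isIntegralOverIdeal
      (fun y hy => (hmem k hk y).mp hy i) hx
  -- With `k = ⌊m/n⌋ + 1`, `f ^ k` reaches level `m` at the smaller centers. The bound on `m` gives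
  -- `⌊m/n⌋ ≥ a_j n`, so the deficit of at least one per factor at `ν_j` outweighs the rounding up.
  refine ⟨a j * n * n + 1, Nat.succ_pos _, fun m hm => ?_⟩
  obtain ⟨k, hk1, hk2⟩ : ∃ k, m ≤ n * k ∧ (a j * n - 1) * k + 1 ≤ a j * m := by
    have hm' := Nat.div_add_mod m n
    have hlt := Nat.mod_lt m hn
    refine ⟨m / n + 1, by nlinarith, ?_⟩
    have hq : a j * n ≤ m / n := (Nat.le_div_iff_mul_le hn).mpr (by omega)
    obtain ⟨b, hb⟩ := Nat.exists_eq_succ_of_ne_zero (han j n hn)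
    rw [hb, Nat.succ_sub_one]
    have : a j * n * (m / n) ≤ a j * m := by
      rw [mul_assoc]
      exact Nat.mul_le_mul_left _ (Nat.mul_div_le m n)
    rw [hb] at this hq
    simp only [Nat.succ_eq_add_one] at this hq
    nlinarith
  have hm1 : 1 ≤ m := by omega
  -- The sum of the `a_i m` is an exponent large enough for every valuation centered at `m_R`.
  refine maximalIdeal_mem_associatedPrimes_quotient (f := f ^ k) (N := ∑ i, a i * m)
    (fun h => (ν j).pow_notMem_valuationIdeal hfj k
      ((ν j).valuationIdeal_anti hk2 ((hmem m hm1 _).mp h j))) fun x hx => ?_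
  rw [hmem m hm1]
  intro i
  by_cases hi : (ν i).center = IsLocalRing.maximalIdeal R
  · refine Ideal.mul_mem_right _ _ ((ν i).center_pow_le_valuationIdeal _ ?_)
    rw [hi]
    exact Ideal.pow_le_pow_right
      (Finset.single_le_sum (f := fun i => a i * m) (fun _ _ => Nat.zero_le _) (Finset.mem_univ i))
      hx
  · refine Ideal.mul_mem_left _ _ ((ν i).valuationIdeal_anti ?_
      ((ν i).pow_mem_valuationIdeal (hfJ i hi) k))
    rw [mul_assoc]
    exact Nat.mul_le_mul_left _ hk1
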